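/- Let $k$ be a field, let $n\ge 0$ be an integer, and let $\Delta$ be a simplicial complex with vertex set $\{x_1,\dots,x_n\}$, i.e. a collection of subsets (called faces) of $\{x_1,\dots,x_n\}$ that contains $\emptyset$ and every singleton $\{x_i\}$ and is closed under taking subsets. The facets of $\Delta$ are its faces that are maximal under inclusion. Let $\mathcal F(\Delta)$ be the facet ideal of $\Delta$, that is, the ideal of the polynomial ring $k[x_1,\dots,x_n]$ generated by the square-free monomials $x_{i_1}\cdots x_{i_s}$ such that $\{x_{i_1},\dots,x_{i_s}\}$ is a facet of $\Delta$. A vertex cover of $\Delta$ is a set $A\subseteq\{x_1,\dots,x_n\}$ that meets every facet of $\Delta$; it is minimal if no proper subset of $A$ is a vertex cover. If the ring $k[x_1,\dots,x_n]/\mathcal F(\Delta)$ is Cohen–Macaulay (that is, it is Noetherian and its localization at every maximal ideal has depth equal to its Krull dimension), then $\Delta$ is unmixed: all minimal vertex covers of $\Delta$ have the same cardinality. -/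

import Mathlib

namespace AbstractSimplicialComplex

variable {V : Type*}

/-- The faces of `Δ`, with the convention that the empty set is a face
(Mathlib's complexes record the nonempty faces only). -/
def IsFace (Δ : AbstractSimplicialComplex V) (F : Finset V) : Prop :=
  F = ∅ ∨ F ∈ Δ

/-- A facet is a face that is maximal under inclusion. -/
def IsFacet (Δ : AbstractSimplicialComplex V) (F : Finset V) : Prop :=
  Maximal Δ.IsFace F

/-- The facet ideal: the ideal of `k[x_v : v ∈ V]` generated by the square-free monomials
`∏ v ∈ F, x_v`, where `F` runs over the facets of `Δ`. -/
noncomputable def facetIdeal (k : Type*) [CommSemiring k] (Δ : AbstractSimplicialComplex V) :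
    Ideal (MvPolynomial V k) :=
  Ideal.span {f | ∃ F : Finset V, Δ.IsFacet F ∧ f = ∏ v ∈ F, MvPolynomial.X v}

/-- A vertex cover is a set of vertices that meets every facet. -/
def IsVertexCover (Δ : AbstractSimplicialComplex V) (A : Finset V) : Prop :=
  ∀ F : Finset V, Δ.IsFacet F → ∃ v ∈ A, v ∈ F

/-- A minimal vertex cover is a vertex cover no proper subset of which is a vertex cover. -/
def IsMinimalVertexCover (Δ : AbstractSimplicialComplex V) (A : Finset V) : Prop :=
  Minimal Δ.IsVertexCover A

/-- `Δ` is unmixed if all its minimal vertex covers have the same cardinality. -/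
def IsUnmixed (Δ : AbstractSimplicialComplex V) : Prop :=
  ∀ A B : Finset V, Δ.IsMinimalVertexCover A → Δ.IsMinimalVertexCover B → A.card = B.card

end AbstractSimplicialComplex

/-- The depth of a local ring: the supremum of the lengths of the regular sequences
contained in its maximal ideal. -/
noncomputable def localRingDepth (R : Type*) [CommRing R] [IsLocalRing R] : ℕ∞ :=
  ⨆ rs : {rs : List R //
    (∀ r ∈ rs, r ∈ IsLocalRing.maximalIdeal R) ∧ RingTheory.Sequence.IsRegular R rs},
    (rs.1.length : ℕ∞)

/-- A local ring is Cohen-Macaulay if it is Noetherian and its depth equals its Krull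
dimension. -/
def IsCohenMacaulayLocalRing (R : Type*) [CommRing R] [IsLocalRing R] : Prop :=
  IsNoetherianRing R ∧ ((localRingDepth R : ℕ∞) : WithBot ℕ∞) = ringKrullDim R

/-- A ring is Cohen-Macaulay if it is Noetherian and its localizations at all maximal ideals
are Cohen-Macaulay local rings. -/
def IsCohenMacaulayRing (R : Type*) [CommRing R] : Prop :=
  IsNoetherianRing R ∧ ∀ (m : Ideal R) [m.IsMaximal],
    IsCohenMacaulayLocalRing (Localization.AtPrime m)

section Depth

open scoped Pointwise

variable {R : Type*} [CommRing R]

/-! For a minimal vertex cover `A`, the prime generated by its variables is minimal over the facet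
ideal. Localize the facet ring at a maximal ideal containing all the variables. In a Cohen-Macaulay
local ring every minimal prime has coheight equal to the depth, because the depth is at most the
coheight of any associated prime. Chains of coordinate primes show that the coheight at `A` is `n -
|A|`. Hence `|A| = n - depth` for every minimal cover. -/

theorem IsAssociatedPrime.exists_lt_of_isSMulRegular [IsLocalRing R] [IsNoetherianRing R]
    {M : Type*} [AddCommGroup M] [Module R M] [Module.Finite R M] {p : Ideal R}
    (hp : IsAssociatedPrime p M) {x : R} (hxm : x ∈ IsLocalRing.maximalIdeal R)
    (hx : IsSMulRegular M x) :
    ∃ q : Ideal R, IsAssociatedPrime q (QuotSMulTop x M) ∧ p < q := by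
  obtain ⟨-, z, hz⟩ := isAssociatedPrime_iff.mp hp
  have hz0 : z ≠ 0 := by
    rintro rfl
    exact hp.isPrime.ne_top (by simp [hz])
  set N := Submodule.torsionBySet R M (p : Set R) with hN
  have hzN : z ∈ N := by
    rw [hN, Submodule.mem_torsionBySet_iff]
    rintro ⟨a, ha⟩
    simpa [hz, Submodule.mem_colon_singleton] using ha
  -- Nakayama: if `N ⊆ xM`, regularity of `x` gives `N = xN`, so `N = 0`, although `z ∈ N`.
  have hNx : ∃ y ∈ N, y ∉ x • (⊤ : Submodule R M) := by
    by_contra! h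
    have hle : N ≤ Ideal.span {x} • N := by
      intro y hy
      obtain ⟨w, -, rfl⟩ := (Submodule.mem_smul_pointwise_iff_exists _ _ _).mp (h y hy)
      refine Submodule.smul_mem_smul (Ideal.mem_span_singleton_self x) ?_
      rw [hN, Submodule.mem_torsionBySet_iff] at hy ⊢
      intro a
      apply hx
      simpa [smul_comm x] using hy a
    have hbot : N = ⊥ :=
      Submodule.eq_bot_of_le_smul_of_le_jacobson_bot _ N (IsNoetherian.noetherian N) hle (by
        rw [IsLocalRing.jacobson_eq_maximalIdeal _ bot_ne_top]
        simpa [Ideal.span_le] using hxm)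
    exact hz0 (by simpa [hbot] using hzN)
  obtain ⟨y, hyN, hy⟩ := hNx
  have hy0 : (Submodule.Quotient.mk y : QuotSMulTop x M) ≠ 0 := by
    simpa [Submodule.Quotient.mk_eq_zero] using hy
  obtain ⟨q, hq, hle⟩ := exists_le_isAssociatedPrime_of_isNoetherianRing R _ hy0
  refine ⟨q, hq, lt_of_le_of_ne (fun a ha => hle ?_) ?_⟩
  · rw [Submodule.mem_colon_singleton, ← Submodule.Quotient.mk_smul,
      (Submodule.mem_torsionBySet_iff _ _).mp hyN ⟨a, ha⟩]
    simp
  -- `x` kills `M/xM`, so `x ∈ q`; but `x ∈ p` would give `x • z = 0`.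
  · rintro rfl
    have hxp : x ∈ p := hle <| by
      rw [Submodule.mem_colon_singleton, Submodule.mem_bot]
      exact Module.mem_annihilator.mp (QuotSMulTop.mem_annihilator (M := M) x) _
    rw [hz, Submodule.mem_colon_singleton, Submodule.mem_bot] at hxp
    exact hz0 (hx (by simpa using hxp))

/-- Each regular element forces a strictly larger associated prime, which builds a chain above `p`.
`M` varies because the induction passes to `M/xM`. -/
theorem RingTheory.Sequence.IsRegular.length_le_coheight [IsLocalRing R] [IsNoetherianRing R]
    (rs : List R) : ∀ {M : Type*} [AddCommGroup M] [Module R M] [Module.Finite R M],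
    RingTheory.Sequence.IsRegular M rs → (∀ r ∈ rs, r ∈ IsLocalRing.maximalIdeal R) →
    ∀ p : PrimeSpectrum R, IsAssociatedPrime p.asIdeal M →
      (rs.length : ℕ∞) ≤ Order.coheight p := by
  induction rs with
  | nil => simp
  | cons x rs ih =>
    intro M _ _ _ hreg hmem p hp
    obtain ⟨hx, hrs⟩ := (RingTheory.Sequence.isRegular_cons_iff M x rs).mp hreg
    obtain ⟨q, hq, hlt⟩ := hp.exists_lt_of_isSMulRegular (hmem x (by simp)) hx
    have h := ih hrs (fun r hr => hmem r (by simp [hr])) ⟨q, hq.isPrime⟩ hq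
    have hlt' : p < ⟨q, hq.isPrime⟩ := hlt
    calc ((x :: rs).length : ℕ∞) = rs.length + 1 := by simp
      _ ≤ Order.coheight (⟨q, hq.isPrime⟩ : PrimeSpectrum R) + 1 := by gcongr
      _ ≤ Order.coheight p := Order.coheight_add_one_le hlt'

theorem localRingDepth_le_coheight [IsLocalRing R] [IsNoetherianRing R] (p : PrimeSpectrum R)
    (hp : IsAssociatedPrime p.asIdeal R) : localRingDepth R ≤ Order.coheight p :=
  iSup_le fun rs => RingTheory.Sequence.IsRegular.length_le_coheight rs.1 rs.2.2 rs.2.1 p hp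

/-- A Cohen-Macaulay local ring is equidimensional. -/
theorem IsCohenMacaulayLocalRing.coheight_eq [IsLocalRing R] (h : IsCohenMacaulayLocalRing R)
    {p : PrimeSpectrum R} (hp : IsMin p) : Order.coheight p = localRingDepth R := by
  have := h.1
  refine le_antisymm ?_ (localRingDepth_le_coheight p ?_)
  · have h' := Order.coheight_le_krullDim p
    rw [← ringKrullDim, ← h.2] at h'
    exact WithBot.coe_le_coe.mp h'
  · refine Module.associatedPrimes.minimalPrimes_annihilator_subset_associatedPrimes R R ?_
    rw [Module.annihilator_eq_bot.mpr inferInstance]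
    exact PrimeSpectrum.isMin_iff.mp hp

end Depth

/-- The spectrum of the localization of `R ⧸ I` at a prime embeds into the spectrum of `R`. -/
theorem PrimeSpectrum.exists_orderEmbedding_localization_quotient {R : Type*} [CommRing R]
    (I : Ideal R) (m : Ideal (R ⧸ I)) [hm : m.IsPrime] :
    ∃ e : PrimeSpectrum (Localization.AtPrime m) ↪o PrimeSpectrum R,
      ∀ p : PrimeSpectrum R, p ∈ Set.range e ↔
        I ≤ p.asIdeal ∧ p.asIdeal ≤ m.comap (Ideal.Quotient.mk I) := by
  let e₁ := IsLocalization.AtPrime.primeSpectrumOrderIso (Localization.AtPrime m) m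
  let e₂ := I.primeSpectrumQuotientOrderIsoZeroLocus
  refine ⟨e₁.toOrderEmbedding.trans ((OrderEmbedding.subtype _).trans
    (e₂.toOrderEmbedding.trans (OrderEmbedding.subtype _))), fun p => ⟨?_, ?_⟩⟩
  · rintro ⟨q, rfl⟩
    exact ⟨(e₂ (e₁ q).1).2, Ideal.comap_mono (e₁ q).2⟩
  · rintro ⟨hI, hp⟩
    obtain ⟨r, hr⟩ := e₂.surjective ⟨p, hI⟩
    have hr' : r ≤ ⟨m, hm⟩ := by
      have hle : e₂ r ≤ e₂ ⟨m, hm⟩ := by rw [hr]; exact hp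
      exact e₂.le_iff_le.mp hle
    obtain ⟨q, hq⟩ := e₁.surjective ⟨r, hr'⟩
    refine ⟨q, ?_⟩
    change (e₂ (e₁ q).1).1 = p
    rw [hq, hr]

theorem Order.height_add_coheight_le_krullDim {α : Type*} [Preorder α] (a : α) :
    ((Order.height a + Order.coheight a : ℕ∞) : WithBot ℕ∞) ≤ Order.krullDim α := by
  have : Nonempty α := ⟨a⟩
  rw [Order.krullDim_eq_iSup_height_add_coheight_of_nonempty, WithBot.coe_le_coe]
  exact le_iSup (fun b : α => Order.height b + Order.coheight b) a

namespace MvPolynomial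

variable {V : Type*} [DecidableEq V] (k : Type*) [Field k]

/-- The prime ideal generated by the variables in `A`, as the kernel of the map that sends
these variables to zero. -/
noncomputable def coordinatePrime (A : Finset V) : PrimeSpectrum (MvPolynomial V k) :=
  ⟨RingHom.ker (aeval (R := k) fun i => if i ∈ A then 0 else (X i : MvPolynomial V k)),
    RingHom.ker_isPrime _⟩

variable {k}

theorem X_mem_coordinatePrime {A : Finset V} {i : V} :
    X i ∈ (coordinatePrime k A).asIdeal ↔ i ∈ A := by
  simp [coordinatePrime, RingHom.mem_ker]

theorem coordinatePrime_asIdeal_le_iff {A : Finset V} {q : Ideal (MvPolynomial V k)} :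
    (coordinatePrime k A).asIdeal ≤ q ↔ ∀ i ∈ A, X i ∈ q := by
  refine ⟨fun h i hi => h (X_mem_coordinatePrime.mpr hi), fun h f hf => ?_⟩
  -- Modulo `q`, setting the variables of `A` to zero changes nothing.
  have key : (Ideal.Quotient.mkₐ k q).comp
      (aeval fun i => if i ∈ A then 0 else (X i : MvPolynomial V k)) =
      Ideal.Quotient.mkₐ k q := by
    refine algHom_ext fun i => ?_
    by_cases hi : i ∈ A
    · simp [hi, (Ideal.Quotient.eq_zero_iff_mem.mpr (h i hi) : Ideal.Quotient.mk q (X i) = 0)]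
    · simp [hi]
  have hf' : aeval (R := k) (fun i => if i ∈ A then 0 else (X i : MvPolynomial V k)) f = 0 := hf
  have := DFunLike.congr_fun key f
  rw [AlgHom.comp_apply, hf', map_zero] at this
  exact Ideal.Quotient.eq_zero_iff_mem.mp this.symm

theorem coordinatePrime_le_iff {A : Finset V} {q : PrimeSpectrum (MvPolynomial V k)} :
    coordinatePrime k A ≤ q ↔ ∀ i ∈ A, X i ∈ q.asIdeal :=
  coordinatePrime_asIdeal_le_iff

theorem coordinatePrime_strictMono : StrictMono (coordinatePrime (V := V) k) :=
  strictMono_of_le_iff_le fun A B => by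
    simp [coordinatePrime_le_iff, X_mem_coordinatePrime, Finset.subset_iff]

theorem card_le_height_coordinatePrime (A : Finset V) :
    (A.card : ℕ∞) ≤ Order.height (coordinatePrime k A) := by
  induction A using Finset.induction_on with
  | empty => simp
  | insert a s ha ih =>
    rw [Finset.card_insert_of_notMem ha, Nat.cast_add, Nat.cast_one]
    exact (add_le_add_left ih 1).trans
      (Order.height_add_one_le (coordinatePrime_strictMono (Finset.ssubset_insert ha)))

/-- Height plus coheight is at most the dimension of the polynomial ring, so a lower bound on the
height suffices. -/
theorem card_add_coheight_coordinatePrime_le [Fintype V] (A : Finset V) :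
    (A.card : ℕ∞) + Order.coheight (coordinatePrime k A) ≤ Fintype.card V := by
  have h := Order.height_add_coheight_le_krullDim (coordinatePrime k A)
  rw [← ringKrullDim, ringKrullDim_of_isNoetherianRing, ringKrullDim_eq_zero_of_field, zero_add,
    Nat.card_eq_fintype_card] at h
  exact (add_le_add_left (card_le_height_coordinatePrime A) _).trans (by exact_mod_cast h)

/-- If an interval of the spectrum contains all coordinate primes above `A`, then the coheight
of the coordinate prime of `A` in it is at least the number of variables outside `A`. -/
theorem card_compl_le_coheight [Fintype V] {α : Type*} [PartialOrder α]
    (e : α ↪o PrimeSpectrum (MvPolynomial V k)) (s : Finset V) :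
    ∀ (A : Finset V) (p : α), s = Aᶜ → e p = coordinatePrime k A →
      (∀ B, A ⊆ B → coordinatePrime k B ∈ Set.range e) →
      (s.card : ℕ∞) ≤ Order.coheight p := by
  induction s using Finset.induction_on with
  | empty => simp
  | insert a s ha ih =>
    intro A p hA hp hrange
    obtain ⟨q, hq⟩ := hrange (insert a A) (Finset.subset_insert a A)
    have haA : a ∉ A := by
      rw [← Finset.mem_compl, ← hA]
      exact Finset.mem_insert_self a s
    have hs : s = (insert a A)ᶜ := by
      rw [Finset.compl_insert, ← hA, Finset.erase_insert ha]
    have h := ih _ q hs hq fun B hB => hrange B ((Finset.subset_insert a A).trans hB)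
    have hlt : p < q := by
      rw [← e.lt_iff_lt, hp, hq]
      exact coordinatePrime_strictMono (Finset.ssubset_insert haA)
    rw [Finset.card_insert_of_notMem ha, Nat.cast_add, Nat.cast_one]
    exact (add_le_add_left h 1).trans (Order.coheight_add_one_le hlt)

end MvPolynomial

namespace AbstractSimplicialComplex

open MvPolynomial

variable {V : Type*} {k : Type*} [Field k] (Δ : AbstractSimplicialComplex V)

theorem facetIdeal_le_iff {q : Ideal (MvPolynomial V k)} [q.IsPrime] :
    Δ.facetIdeal k ≤ q ↔ ∀ F, Δ.IsFacet F → ∃ v ∈ F, X v ∈ q := by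
  rw [facetIdeal, Ideal.span_le]
  constructor
  · intro h F hF
    exact Ideal.IsPrime.prod_mem_iff.mp (h ⟨F, hF, rfl⟩)
  · rintro h _ ⟨F, hF, rfl⟩
    exact Ideal.IsPrime.prod_mem_iff.mpr (h F hF)

theorem facetIdeal_le_coordinatePrime_iff [DecidableEq V] {A : Finset V} :
    Δ.facetIdeal k ≤ (coordinatePrime k A).asIdeal ↔ Δ.IsVertexCover A := by
  simp only [facetIdeal_le_iff, X_mem_coordinatePrime, IsVertexCover, and_comm]

theorem IsMinimalVertexCover.eq_coordinatePrime [DecidableEq V] {A : Finset V}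
    (hA : Δ.IsMinimalVertexCover A) {q : PrimeSpectrum (MvPolynomial V k)}
    (hq : Δ.facetIdeal k ≤ q.asIdeal) (hqA : q ≤ coordinatePrime k A) :
    q = coordinatePrime k A := by
  classical
  refine le_antisymm hqA (coordinatePrime_le_iff.mpr fun i hi => ?_)
  -- Since `q` is prime, the variables of `A` in `q` already cover; minimality then makes them all
  -- of `A`.
  have hcover : Δ.IsVertexCover (A.filter fun i => (X i : MvPolynomial V k) ∈ q.asIdeal) := by
    intro F hF
    obtain ⟨v, hv, hvq⟩ := Δ.facetIdeal_le_iff.mp hq F hF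
    exact ⟨v, Finset.mem_filter.mpr ⟨X_mem_coordinatePrime.mp (hqA hvq), hvq⟩, hv⟩
  exact (Finset.mem_filter.mp (hA.2 hcover (Finset.filter_subset _ _) hi)).2

/-- In the localization of a Cohen-Macaulay facet ring at a maximal ideal containing all the
variables, the size of a minimal vertex cover is determined by the depth. -/
theorem IsMinimalVertexCover.card_add_localRingDepth [DecidableEq V] [Fintype V]
    {A : Finset V} (hA : Δ.IsMinimalVertexCover A)
    (m : Ideal (MvPolynomial V k ⧸ Δ.facetIdeal k)) [m.IsPrime]
    (hm : (coordinatePrime k Finset.univ).asIdeal ≤ m.comap (Ideal.Quotient.mk _))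
    (hCM : IsCohenMacaulayLocalRing (Localization.AtPrime m)) :
    (A.card : ℕ∞) + localRingDepth (Localization.AtPrime m) = Fintype.card V := by
  obtain ⟨e, he⟩ := PrimeSpectrum.exists_orderEmbedding_localization_quotient _ m
  have hrange : ∀ B, A ⊆ B → coordinatePrime k B ∈ Set.range e := fun B hB =>
    (he _).mpr ⟨(Δ.facetIdeal_le_coordinatePrime_iff.mpr hA.1).trans
      (coordinatePrime_strictMono.monotone hB),
      le_trans (coordinatePrime_strictMono.monotone (Finset.subset_univ B)) hm⟩
  obtain ⟨p, hp⟩ := hrange A subset_rfl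
  have hmin : IsMin p := fun q hq => by
    have hqA : e q ≤ coordinatePrime k A := hp ▸ e.monotone hq
    have := hA.eq_coordinatePrime Δ ((he _).mp ⟨q, rfl⟩).1 hqA
    exact (e.injective (hp.trans this.symm)).le
  rw [← hCM.coheight_eq hmin]
  apply le_antisymm
  · refine le_trans ?_ (card_add_coheight_coordinatePrime_le (k := k) A)
    rw [← hp]
    exact add_le_add_right (Order.coheight_le_coheight_apply_of_strictMono _ e.strictMono p) _
  · rw [← Finset.card_add_card_compl A, Nat.cast_add]
    exact add_le_add_right (card_compl_le_coheight e _ A p rfl hp hrange) _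

end AbstractSimplicialComplex

theorem mainTheorem9 {k : Type*} [Field k] {n : ℕ} (Δ : AbstractSimplicialComplex (Fin n))
    (hCM : IsCohenMacaulayRing (MvPolynomial (Fin n) k ⧸ Δ.facetIdeal k)) :
    Δ.IsUnmixed := by
  intro A B hA hB
  -- The existence of a cover matters: if `∅` were a facet, the facet ideal would be the unit ideal.
  have hI : Δ.facetIdeal k ≤ (MvPolynomial.coordinatePrime k Finset.univ).asIdeal :=
    (Δ.facetIdeal_le_coordinatePrime_iff.mpr hA.1).trans
      (MvPolynomial.coordinatePrime_strictMono.monotone (Finset.subset_univ A))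
  have hprime := Ideal.map_isPrime_of_surjective (I := (MvPolynomial.coordinatePrime k
    (Finset.univ : Finset (Fin n))).asIdeal) (f := Ideal.Quotient.mk (Δ.facetIdeal k))
    Ideal.Quotient.mk_surjective (by rwa [Ideal.mk_ker])
  obtain ⟨m, hmax, hm⟩ := Ideal.exists_le_maximal _ hprime.ne_top
  have hm' := Ideal.map_le_iff_le_comap.mp hm
  have h₁ := hA.card_add_localRingDepth Δ m hm' (hCM.2 m)
  have h₂ := hB.card_add_localRingDepth Δ m hm' (hCM.2 m)
  -- Cancellation in `ℕ∞` requires finite depth.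
  have hfin : localRingDepth (Localization.AtPrime m) ≠ ⊤ := by
    intro h
    simp [h] at h₁
  lift localRingDepth (Localization.AtPrime m) to ℕ using hfin with d
  norm_cast at h₁ h₂
  omega
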